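/- Consider the planar polynomial differential system \[ \dot x=-(x-y)(x^2-xy+y^2)+x(2x^4+2x^2y^2+y^4),\qquad \dot y=-(x+y)(2x^2-xy+2y^2)+y(2x^4+2x^2y^2+y^4). \] Let \[ \psi(\theta)=2\int_0^\theta\frac{1+\tan^2 s}{2+\tan^2 s}\,ds,\qquad w(s)=\frac{\cos^4 s+1}{\cos^2 s+1}\,e^{3\psi(s)-2s},\qquad a=\frac{2e^{4\pi-6\sqrt2\pi}}{1-e^{4\pi-6\sqrt2\pi}}\int_0^{2\pi}w(s)\,ds . \] Then $a\approx 1.19903$, precisely $|a-1.19903|\le 5\cdot10^{-6}$; one has $a+2\int_0^\theta w(s)\,ds>0$ for all $\theta\in\mathbb R$; and \[ r(\theta)=e^{\frac32\psi(\theta)-\theta}\Bigl(a+2\int_0^\theta w(s)\,ds\Bigr)^{-1/2} \] is a $2\pi$-periodic function of $\theta$. The system has exactly one limit cycle (isolated periodic orbit), namely the curve given in polar coordinates by $r=r(\theta)$. This limit cycle is hyperbolic, i.e. the derivative of its Poincaré return map at the cycle does not have absolute value $1$. It is not algebraic, i.e. it is not an oval of any real invariant algebraic curve: there is no nonzero real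 polynomial $F(x,y)$ that vanishes on the cycle and satisfies $\dot x\,\partial F/\partial x+\dot y\,\partial F/\partial y=KF$ for some real polynomial $K$, where $\dot x,\dot y$ stand for the right-hand sides of the system. -/

import Mathlib

noncomputable section

namespace PlanarSystem

/-- `Γ` is a periodic orbit of the autonomous planar system `z' = V z`: the range of a nonconstant
periodic solution defined for all times. -/
def IsPeriodicOrbit (V : ℝ × ℝ → ℝ × ℝ) (Γ : Set (ℝ × ℝ)) : Prop :=
  ∃ (γ : ℝ → ℝ × ℝ) (T : ℝ), IsIntegralCurve γ (fun _ => V) ∧ 0 < T ∧ Function.Periodic γ T ∧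
    (∃ t, γ t ≠ γ 0) ∧ Γ = Set.range γ

/-- A limit cycle is an isolated periodic orbit: some neighbourhood of it contains no other
periodic orbit. -/
def IsLimitCycle (V : ℝ × ℝ → ℝ × ℝ) (Γ : Set (ℝ × ℝ)) : Prop :=
  IsPeriodicOrbit V Γ ∧ ∃ U : Set (ℝ × ℝ), IsOpen U ∧ Γ ⊆ U ∧
    ∀ Γ', IsPeriodicOrbit V Γ' → Γ' ⊆ U → Γ' = Γ

/-- `π` is the Poincaré (first return) map, on the parameter interval `(-ε, ε)`, of the
transversal segment `Σ = {p + u • v : |u| < δ}`: for every `|s| < ε` the solution starting at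
`p + s • v` comes back to `Σ` in positive time, and it does so for the first time at the point
`p + π s • v`. -/
def IsReturnMap (V : ℝ × ℝ → ℝ × ℝ) (p v : ℝ × ℝ) (δ ε : ℝ) (π : ℝ → ℝ) : Prop :=
  (∀ u : ℝ, |u| < δ → LinearIndependent ℝ ![v, V (p + u • v)]) ∧
  ∀ s : ℝ, |s| < ε → |π s| < δ ∧
    ∃ (γ : ℝ → ℝ × ℝ) (τ : ℝ), 0 < τ ∧ IsIntegralCurveOn γ (fun _ => V) (Set.Icc 0 τ) ∧
      γ 0 = p + s • v ∧ γ τ = p + π s • v ∧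
      ∀ t ∈ Set.Ioo 0 τ, ∀ u : ℝ, |u| < δ → γ t ≠ p + u • v

/-- A periodic orbit is hyperbolic if its characteristic multiplier, the derivative at the orbit of
the Poincaré return map of a transversal segment, does not have absolute value `1`. (The multiplier
does not depend on the transversal segment that is used to compute it.) -/
def IsHyperbolic (V : ℝ × ℝ → ℝ × ℝ) (Γ : Set (ℝ × ℝ)) : Prop :=
  IsPeriodicOrbit V Γ ∧
    ∃ p ∈ Γ, ∃ (v : ℝ × ℝ) (δ ε : ℝ) (π : ℝ → ℝ) (m : ℝ), 0 < ε ∧ ε ≤ δ ∧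
      IsReturnMap V p v δ ε π ∧ π 0 = 0 ∧ HasDerivAt π m 0 ∧ |m| ≠ 1

/-- Evaluation of a real polynomial in the two variables `x = X 0`, `y = X 1`. -/
def polyEval (F : MvPolynomial (Fin 2) ℝ) (z : ℝ × ℝ) : ℝ :=
  MvPolynomial.eval ![z.1, z.2] F

/-- The vector field of the polynomial system `x' = P (x, y)`, `y' = Q (x, y)`. -/
def polyField (P Q : MvPolynomial (Fin 2) ℝ) (z : ℝ × ℝ) : ℝ × ℝ :=
  (polyEval P z, polyEval Q z)

/-- `F` is a real algebraic solution of `x' = P`, `y' = Q`: a nonzero real polynomial with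
`F_x P + F_y Q = K F` for some polynomial `K`, the cofactor. -/
def IsAlgebraicSolution (P Q F : MvPolynomial (Fin 2) ℝ) : Prop :=
  F ≠ 0 ∧ ∃ K : MvPolynomial (Fin 2) ℝ,
    MvPolynomial.pderiv 0 F * P + MvPolynomial.pderiv 1 F * Q = K * F

/-- `Γ` is an algebraic periodic orbit: it is an oval of a real algebraic solution. A periodic orbit
is already a simple closed curve, so being an oval of the curve `F = 0` means to lie on it. -/
def IsAlgebraicOrbit (P Q : MvPolynomial (Fin 2) ℝ) (Γ : Set (ℝ × ℝ)) : Prop :=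
  IsPeriodicOrbit (polyField P Q) Γ ∧
    ∃ F, IsAlgebraicSolution P Q F ∧ ∀ z ∈ Γ, polyEval F z = 0

section Quintic

open MvPolynomial

/-- `-(x - y)(x² - xy + y²) + x (2x⁴ + 2x²y² + y⁴)` -/
def quinticP : MvPolynomial (Fin 2) ℝ :=
  -(X 0 - X 1) * (X 0 ^ 2 - X 0 * X 1 + X 1 ^ 2)
    + X 0 * (2 * X 0 ^ 4 + 2 * X 0 ^ 2 * X 1 ^ 2 + X 1 ^ 4)

/-- `-(x + y)(2x² - xy + 2y²) + y (2x⁴ + 2x²y² + y⁴)` -/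
def quinticQ : MvPolynomial (Fin 2) ℝ :=
  -(X 0 + X 1) * (2 * X 0 ^ 2 - X 0 * X 1 + 2 * X 1 ^ 2)
    + X 1 * (2 * X 0 ^ 4 + 2 * X 0 ^ 2 * X 1 ^ 2 + X 1 ^ 4)

end Quintic

/-- `ψ(θ) = 2 ∫₀^θ (1 + tan² s) / (2 + tan² s) ds`; the integrand is bounded and it is undefined
only at the isolated zeros of `cos`. -/
def psi (θ : ℝ) : ℝ :=
  2 * ∫ s in (0 : ℝ)..θ, (1 + Real.tan s ^ 2) / (2 + Real.tan s ^ 2)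

/-- `(cos⁴ s + 1) / (cos² s + 1) · e^{3ψ(s) - 2s}` -/
def weight (s : ℝ) : ℝ :=
  (Real.cos s ^ 4 + 1) / (Real.cos s ^ 2 + 1) * Real.exp (3 * psi s - 2 * s)

/-- `a = 2A / (1 - A) · ∫₀^{2π} weight` with `A = e^{4π - 6√2 π}`. -/
def aConst : ℝ :=
  2 * Real.exp (4 * Real.pi - 6 * √2 * Real.pi) /
      (1 - Real.exp (4 * Real.pi - 6 * √2 * Real.pi)) *
    ∫ s in (0 : ℝ)..(2 * Real.pi), weight s

/-- `a + 2 ∫₀^θ weight` -/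
def radicand (θ : ℝ) : ℝ :=
  aConst + 2 * ∫ s in (0 : ℝ)..θ, weight s

/-- `r(θ) = e^{(3/2) ψ(θ) - θ} (a + 2 ∫₀^θ weight)^{-1/2}` -/
def radius (θ : ℝ) : ℝ :=
  Real.exp (3 / 2 * psi θ - θ) * radicand θ ^ (-(1 / 2) : ℝ)

/-- The curve with polar equation `r = ρ(θ)`. -/
def polarCurve (ρ : ℝ → ℝ) : Set (ℝ × ℝ) :=
  Set.range fun θ : ℝ => (ρ θ * Real.cos θ, ρ θ * Real.sin θ)

end PlanarSystem

end

open PlanarSystem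

/-! In polar coordinates the system reads r' / r = r⁴(1 + cos⁴ θ) - r²(1 + sin² θ), θ' = -r²(1 +
cos² θ), so u = r⁻² satisfies a linear equation in θ (`hasDerivAt_invSq`). Its homogeneous solution
`decay` shrinks by `growth⁻¹` < 1 per turn, and `aConst` is the initial value of the periodic
solution `invSq 0`, which is positive and so defines a closed orbit.

Along any periodic orbit the deviation v = r⁻² - `invSq 0` solves v' = 2(x² + 2y²)v. Its factor over
a period exceeds 1 while v returns to its value, so v = 0: this gives uniqueness
(`eq_polarCurve_of_isPeriodicOrbit`). In the variable u the return map is affine with slope `growth`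
> 1, whence hyperbolicity.

For non-algebraicity, put y = t x and q = x⁻². A nonzero polynomial vanishing on the cycle makes q
algebraic over ℝ(t), while q solves a linear equation with polynomial coefficients. That equation
then has a rational solution (`exists_rational_solution`), which the local exponents at its singular
points and a degree count exclude (`no_rational_solution`).

The value of a comes from a trigonometric polynomial that nearly solves the equation for u, with the
error controlled at the extrema of the difference. -/

noncomputable section

namespace PlanarSystem

/-! ### The linear equation for r⁻² and its periodic solution -/

section PeriodicSolution

open Real intervalIntegral MeasureTheory

lemma one_add_cos_sq_pos (θ : ℝ) : 0 < 1 + cos θ ^ 2 := by positivity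

lemma continuous_two_div_one_add_cos_sq : Continuous fun s : ℝ => 2 / (1 + cos s ^ 2) := by
  refine continuous_const.div (by fun_prop) fun s => (one_add_cos_sq_pos s).ne'

lemma tan_quotient_eq {s : ℝ} (h : cos s ≠ 0) :
    (1 + tan s ^ 2) / (2 + tan s ^ 2) = 1 / (1 + cos s ^ 2) := by
  have h1 := one_add_cos_sq_pos s
  rw [tan_eq_sin_div_cos, div_eq_div_iff (by positivity) h1.ne']
  field_simp
  linear_combination (cos s ^ 2) * sin_sq_add_cos_sq s

lemma ae_cos_ne_zero : ∀ᵐ s : ℝ, cos s ≠ 0 := by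
  have : ({s : ℝ | cos s = 0}).Countable := by
    have h : {s : ℝ | cos s = 0} = Set.range fun k : ℤ => (2 * k + 1) * π / 2 := by
      ext s
      rw [Set.mem_ofPred_eq, cos_eq_zero_iff]
      simp [eq_comm]
    rw [h]
    exact Set.countable_range _
  exact this.ae_notMem volume

/-- At a zero of cos the convention tan = 0 makes the integrand 1/2 rather than its limit 1; this
affects only a null set. -/
lemma psi_eq (θ : ℝ) : psi θ = ∫ s in (0 : ℝ)..θ, 2 / (1 + cos s ^ 2) := by
  rw [psi, ← intervalIntegral.integral_const_mul]
  refine integral_congr_ae ?_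
  filter_upwards [ae_cos_ne_zero] with s hs _
  rw [tan_quotient_eq hs]
  ring

lemma hasDerivAt_psi (θ : ℝ) : HasDerivAt psi (2 / (1 + cos θ ^ 2)) θ := by
  have h : psi = fun θ => ∫ s in (0 : ℝ)..θ, 2 / (1 + cos s ^ 2) := funext psi_eq
  rw [h]
  exact continuous_two_div_one_add_cos_sq.integral_hasStrictDerivAt 0 θ |>.hasDerivAt

lemma psi_zero : psi 0 = 0 := by simp [psi]

/-- A globally smooth antiderivative of `2 / (1 + cos² θ)`. -/
def psiClosed (θ : ℝ) : ℝ :=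
  √2 * (θ + arctan ((1 - √2) * (sin θ * cos θ) / (√2 * cos θ ^ 2 + sin θ ^ 2)))

/-- The usual antiderivative √2 arctan(tan θ / √2) jumps at the zeros of cos. Here arctan(tan θ /
√2) - θ is rewritten by the subtraction formula for tan, whose denominator never vanishes; the
increment of `psi` over a turn is then explicit. -/
lemma hasDerivAt_psiClosed (θ : ℝ) : HasDerivAt psiClosed (2 / (1 + cos θ ^ 2)) θ := by
  have hw : √2 ^ 2 = 2 := sq_sqrt (by norm_num)
  have hw1 : 1 < √2 := by
    rw [Real.lt_sqrt] <;> norm_num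
  have hp := sin_sq_add_cos_sq θ
  have hd : 0 < √2 * cos θ ^ 2 + sin θ ^ 2 := by nlinarith [sq_nonneg (cos θ), sq_nonneg (sin θ)]
  have hn : HasDerivAt (fun θ => (1 - √2) * (sin θ * cos θ))
      ((1 - √2) * (cos θ * cos θ + sin θ * -sin θ)) θ :=
    ((hasDerivAt_sin θ).mul (hasDerivAt_cos θ)).const_mul _
  have hdd : HasDerivAt (fun θ => √2 * cos θ ^ 2 + sin θ ^ 2)
      (√2 * (2 * cos θ * -sin θ) + 2 * sin θ * cos θ) θ := by
    have := (((hasDerivAt_cos θ).fun_pow 2).const_mul √2).fun_add ((hasDerivAt_sin θ).fun_pow 2)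
    refine this.congr_deriv ?_
    norm_num
  have := ((hasDerivAt_id' θ).fun_add (hn.fun_div hdd hd.ne').arctan).const_mul √2
  refine this.congr_deriv ?_
  have h1 := one_add_cos_sq_pos θ
  have key : 1 + ((1 - √2) * (sin θ * cos θ) / (√2 * cos θ ^ 2 + sin θ ^ 2)) ^ 2
      = (1 + cos θ ^ 2) / (√2 * cos θ ^ 2 + sin θ ^ 2) ^ 2 := by
    field_simp
    linear_combination (cos θ ^ 4 + cos θ ^ 2 * sin θ ^ 2) * hw +
      (2 * cos θ ^ 2 + sin θ ^ 2 + 1) * hp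
  have key2 : (1 - √2) * (cos θ * cos θ + sin θ * -sin θ) * (√2 * cos θ ^ 2 + sin θ ^ 2) -
      (1 - √2) * (sin θ * cos θ) * (√2 * (2 * cos θ * -sin θ) + 2 * sin θ * cos θ)
      = (1 - √2) * (√2 * cos θ ^ 2 - sin θ ^ 2) := by
    linear_combination (1 - √2) * (√2 * cos θ ^ 2 - sin θ ^ 2) * hp
  rw [key, key2]
  field_simp
  linear_combination √2 * (√2 - 1) * hp + (1 - √2 * cos θ ^ 2) * hw

lemma psi_eq_psiClosed (θ : ℝ) : psi θ = psiClosed θ := by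
  have h : ∀ x, HasDerivAt (fun x => psi x - psiClosed x) 0 x := fun x => by
    simpa using (hasDerivAt_psi x).fun_sub (hasDerivAt_psiClosed x)
  have := is_const_of_deriv_eq_zero (fun x => (h x).differentiableAt) (fun x => (h x).deriv) θ 0
  simp only [psi_zero] at this
  have h0 : psiClosed 0 = 0 := by simp [psiClosed]
  linarith

lemma psi_add_two_pi (θ : ℝ) : psi (θ + 2 * π) = psi θ + 2 * √2 * π := by
  simp only [psi_eq_psiClosed, psiClosed, sin_add_two_pi, cos_add_two_pi]
  ring

lemma continuous_psi : Continuous psi :=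
  continuous_iff_continuousAt.2 fun θ => (hasDerivAt_psi θ).continuousAt

lemma continuous_weight : Continuous weight := by
  unfold weight
  have := continuous_psi
  refine Continuous.mul (Continuous.div (by fun_prop) (by fun_prop) fun s => by positivity)
    (by fun_prop)

lemma weight_pos (s : ℝ) : 0 < weight s := by
  unfold weight; positivity

/-- The growth factor of the weight over one turn. -/
def growth : ℝ := exp (6 * √2 * π - 4 * π)

lemma growth_pos : 0 < growth := exp_pos _

lemma one_lt_growth : 1 < growth := by
  have hw1 : 1 < √2 := by
    rw [Real.lt_sqrt] <;> norm_num
  rw [growth, one_lt_exp_iff]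
  nlinarith [pi_pos]

lemma weight_add_two_pi (s : ℝ) : weight (s + 2 * π) = growth * weight s := by
  rw [weight, weight, psi_add_two_pi, cos_add_two_pi, growth,
    show 3 * (psi s + 2 * √2 * π) - 2 * (s + 2 * π)
      = (6 * √2 * π - 4 * π) + (3 * psi s - 2 * s) by ring, exp_add]
  ring

lemma aConst_eq : aConst = 2 / (growth - 1) * ∫ s in (0 : ℝ)..(2 * π), weight s := by
  have h := one_lt_growth
  have : exp (4 * π - 6 * √2 * π) = growth⁻¹ := by
    rw [growth, ← exp_neg]; ring_nf
  rw [aConst, this]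
  congr 1
  have : growth - 1 ≠ 0 := by linarith
  have := growth_pos.ne'
  have : 1 - growth⁻¹ ≠ 0 := by
    intro h0
    field_simp at h0
    linarith
  field_simp

lemma hasDerivAt_radicand (θ : ℝ) : HasDerivAt radicand (2 * weight θ) θ :=
  ((continuous_weight.integral_hasStrictDerivAt 0 θ).hasDerivAt.const_mul 2).const_add _

lemma integral_weight_add_two_pi (θ : ℝ) :
    ∫ s in (0 : ℝ)..(θ + 2 * π), weight s =
      (∫ s in (0 : ℝ)..(2 * π), weight s) + growth * ∫ s in (0 : ℝ)..θ, weight s := by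
  have hi := fun a b => continuous_weight.intervalIntegrable (μ := volume) a b
  rw [← integral_add_adjacent_intervals (hi 0 (2 * π)) (hi _ _), ← intervalIntegral.integral_const_mul]
  congr 1
  have := integral_comp_add_right (a := 0) (b := θ) weight (2 * π)
  simp only [weight_add_two_pi, zero_add] at this
  exact this.symm

/-- This is the property for which `aConst` is chosen: the growth of `radicand` over a turn cancels
that of `decay`. -/
lemma radicand_add_two_pi (θ : ℝ) : radicand (θ + 2 * π) = growth * radicand θ := by
  have h := one_lt_growth
  have : growth - 1 ≠ 0 := by linarith
  rw [radicand, radicand, integral_weight_add_two_pi, aConst_eq]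
  field_simp
  ring

lemma radicand_strictMono : StrictMono radicand :=
  strictMono_of_hasDerivAt_pos hasDerivAt_radicand fun θ => by have := weight_pos θ; positivity

/-- An increasing function that one turn multiplies by a factor above 1 must be positive. -/
lemma radicand_pos (θ : ℝ) : 0 < radicand θ := by
  have h := radicand_strictMono (show θ < θ + 2 * π by linarith [pi_pos])
  rw [radicand_add_two_pi] at h
  nlinarith [one_lt_growth]

/-- The homogeneous solution of the linear equation for `r⁻²`. -/
def decay (θ : ℝ) : ℝ := exp (2 * θ - 3 * psi θ)

lemma decay_pos (θ : ℝ) : 0 < decay θ := exp_pos _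

lemma decay_zero : decay 0 = 1 := by simp [decay, psi_zero]

lemma decay_add_two_pi (θ : ℝ) : decay (θ + 2 * π) = growth⁻¹ * decay θ := by
  rw [decay, decay, growth, ← exp_neg, ← exp_add, psi_add_two_pi]
  ring_nf

lemma hasDerivAt_decay (θ : ℝ) :
    HasDerivAt decay (-(2 * (1 + sin θ ^ 2) / (1 + cos θ ^ 2)) * decay θ) θ := by
  have := (((hasDerivAt_id' θ).const_mul 2).fun_sub ((hasDerivAt_psi θ).const_mul 3)).exp
  refine this.congr_deriv ?_
  have h := one_add_cos_sq_pos θ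
  have hp := sin_sq_add_cos_sq θ
  simp only [decay]
  field_simp
  rw [show sin θ ^ 2 = 1 - cos θ ^ 2 by linarith]
  ring

/-- The solution of the linear equation for `r⁻²` that differs from the periodic one by `K` at
`θ = 0`. -/
def invSq (K θ : ℝ) : ℝ := (radicand θ + K) * decay θ

lemma invSq_eq (K θ : ℝ) : invSq K θ = invSq 0 θ + K * decay θ := by
  simp only [invSq]; ring

lemma hasDerivAt_invSq (K θ : ℝ) :
    HasDerivAt (invSq K)
      ((2 * (1 + cos θ ^ 4) - 2 * (1 + sin θ ^ 2) * invSq K θ) / (1 + cos θ ^ 2)) θ := by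
  refine (((hasDerivAt_radicand θ).add_const K).mul (hasDerivAt_decay θ)).congr_deriv ?_
  have h := one_add_cos_sq_pos θ
  have hw : weight θ * decay θ = (1 + cos θ ^ 4) / (1 + cos θ ^ 2) := by
    rw [weight, decay, mul_assoc, ← exp_add]
    ring_nf
    simp
  rw [mul_assoc 2, hw, invSq]
  field_simp
  ring

lemma invSq_zero_pos (θ : ℝ) : 0 < invSq 0 θ := by
  have := radicand_pos θ
  have := decay_pos θ
  unfold invSq
  positivity

lemma invSq_zero_periodic : Function.Periodic (invSq 0) (2 * π) := fun θ => by
  have := growth_pos.ne'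
  simp only [invSq, radicand_add_two_pi, decay_add_two_pi]
  field_simp
  ring

lemma continuous_invSq (K : ℝ) : Continuous (invSq K) :=
  continuous_iff_continuousAt.2 fun θ => (hasDerivAt_invSq K θ).continuousAt

lemma radius_eq (θ : ℝ) : radius θ = (√(invSq 0 θ))⁻¹ := by
  have hr := radicand_pos θ
  have hd := decay_pos θ
  rw [radius, invSq, add_zero, sqrt_mul hr.le, mul_inv, mul_comm, decay, ← exp_half, ← exp_neg,
    rpow_neg hr.le, ← sqrt_eq_rpow]
  congr 2
  ring

lemma radius_pos (θ : ℝ) : 0 < radius θ := by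
  rw [radius_eq]
  have := invSq_zero_pos θ
  positivity

lemma radius_periodic : Function.Periodic radius (2 * π) := fun θ => by
  rw [radius_eq, radius_eq, invSq_zero_periodic θ]

lemma invSq_zero_zero : invSq 0 0 = aConst := by
  simp [invSq, decay_zero, radicand]

end PeriodicSolution

/-! ### Numerical value of a -/

section Approximation

open Real

/-- The cosine coefficients of an approximation of the periodic solution `invSq 0`. -/
def cosCoeff : ℕ → ℝ
  | 0 => 91643092 / 100000000
  | 1 => 30771709 / 100000000
  | 2 => -2295923 / 100000000
  | 3 => -281942 / 100000000
  | 4 => 77105 / 100000000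
  | 5 => -12525 / 100000000
  | 6 => 1735 / 100000000
  | 7 => -219 / 100000000
  | 8 => 25 / 100000000
  | _ => 0

/-- The sine coefficients of an approximation of the periodic solution `invSq 0`. -/
def sinCoeff : ℕ → ℝ
  | 0 => 0 / 100000000
  | 1 => 30913157 / 100000000
  | 2 => 5440534 / 100000000
  | 3 => -644753 / 100000000
  | 4 => 49329 / 100000000
  | 5 => -1347 / 100000000
  | 6 => -485 / 100000000
  | 7 => 148 / 100000000
  | 8 => -29 / 100000000
  | _ => 0

/-- A trigonometric polynomial close to the periodic solution `invSq 0`. -/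
def approx (θ : ℝ) : ℝ :=
  ∑ k ∈ Finset.range 9, (cosCoeff k * cos (2 * k * θ) + sinCoeff k * sin (2 * k * θ))

/-- The derivative of `approx`. -/
def approxDeriv (θ : ℝ) : ℝ :=
  ∑ k ∈ Finset.range 9, 2 * k *
    (sinCoeff k * cos (2 * k * θ) - cosCoeff k * sin (2 * k * θ))

lemma hasDerivAt_approx (θ : ℝ) : HasDerivAt approx (approxDeriv θ) θ := by
  refine HasDerivAt.fun_sum fun k _ => ?_
  have h := (hasDerivAt_id' θ).const_mul (2 * (k : ℝ))
  exact ((h.cos.const_mul (cosCoeff k)).fun_add (h.sin.const_mul (sinCoeff k))).congr_deriv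
    (by ring)

lemma approx_periodic : Function.Periodic approx (2 * π) := fun θ => by
  refine Finset.sum_congr rfl fun k _ => ?_
  rw [show 2 * (k : ℝ) * (θ + 2 * π) = 2 * k * θ + (2 * k : ℕ) * (2 * π) by
    push_cast; ring, cos_add_nat_mul_two_pi, sin_add_nat_mul_two_pi]

lemma approx_zero : approx 0 = 119903057 / 100000000 := by
  norm_num [approx, cosCoeff, Finset.sum_range_succ]

/-- Only even frequencies occur because the equation has π-periodic coefficients. The residual
consists of the rounding of the coefficients and of the truncation, visible at frequency 18. -/
lemma approx_residual (θ : ℝ) :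
    |(1 + cos θ ^ 2) * approxDeriv θ + 2 * (1 + sin θ ^ 2) * approx θ - 2 * (1 + cos θ ^ 4)|
      ≤ 6 / 1000000 := by
  have hcos : cos θ ^ 2 = (1 + cos (2 * θ)) / 2 := by rw [cos_two_mul]; ring
  have hsin : sin θ ^ 2 = (1 - cos (2 * θ)) / 2 := by rw [sin_sq, hcos]; ring
  have hc : ∀ k : ℝ, cos (2 * θ) * cos (2 * k * θ) =
      (cos (2 * (k + 1) * θ) + cos (2 * (k - 1) * θ)) / 2 := fun k => by
    rw [show 2 * (k + 1) * θ = 2 * k * θ + 2 * θ by ring,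
      show 2 * (k - 1) * θ = 2 * k * θ - 2 * θ by ring, cos_add, cos_sub]
    ring
  have hs : ∀ k : ℝ, cos (2 * θ) * sin (2 * k * θ) =
      (sin (2 * (k + 1) * θ) + sin (2 * (k - 1) * θ)) / 2 := fun k => by
    rw [show 2 * (k + 1) * θ = 2 * k * θ + 2 * θ by ring,
      show 2 * (k - 1) * θ = 2 * k * θ - 2 * θ by ring, sin_add, sin_sub]
    ring
  have key : (1 + cos θ ^ 2) * approxDeriv θ + 2 * (1 + sin θ ^ 2) * approx θ
      - 2 * (1 + cos θ ^ 4) =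
      3 / 200000000 * cos (2 * θ) + 1 / 200000000 * cos (4 * θ) - 7 / 200000000 * sin (4 * θ) -
      4 / 200000000 * cos (6 * θ) + 1 / 200000000 * sin (6 * θ) - 1 / 200000000 * cos (8 * θ) +
      5 / 200000000 * sin (8 * θ) + 6 / 200000000 * cos (10 * θ) - 6 / 200000000 * sin (10 * θ)
      - 5 / 200000000 * cos (12 * θ) - 13 / 200000000 * sin (12 * θ) - 10 / 200000000 * sin (14
      * θ) + 13 / 200000000 * cos (16 * θ) + 11 / 200000000 * sin (16 * θ) - 257 / 200000000 *
      cos (18 * θ) - 171 / 200000000 * sin (18 * θ) := by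
    rw [show cos θ ^ 4 = (cos θ ^ 2) ^ 2 by ring, hcos, hsin]
    simp only [approx, approxDeriv, cosCoeff, sinCoeff, Finset.sum_range_succ, Finset.sum_range_zero]
    have hc1 : cos (2 * θ) * cos (2 * θ) = (cos (4 * θ) + 1) / 2 := by
      have := hc 1; norm_num at this ⊢; exact this
    have hs1 : cos (2 * θ) * sin (2 * θ) = (sin (4 * θ) + 0) / 2 := by
      have := hs 1; norm_num at this ⊢; exact this
    have hc2 : cos (2 * θ) * cos (4 * θ) = (cos (6 * θ) + cos (2 * θ)) / 2 := by
      have := hc 2; norm_num at this ⊢; exact this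
    have hs2 : cos (2 * θ) * sin (4 * θ) = (sin (6 * θ) + sin (2 * θ)) / 2 := by
      have := hs 2; norm_num at this ⊢; exact this
    have hc3 : cos (2 * θ) * cos (6 * θ) = (cos (8 * θ) + cos (4 * θ)) / 2 := by
      have := hc 3; norm_num at this ⊢; exact this
    have hs3 : cos (2 * θ) * sin (6 * θ) = (sin (8 * θ) + sin (4 * θ)) / 2 := by
      have := hs 3; norm_num at this ⊢; exact this
    have hc4 : cos (2 * θ) * cos (8 * θ) = (cos (10 * θ) + cos (6 * θ)) / 2 := by
      have := hc 4; norm_num at this ⊢; exact this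
    have hs4 : cos (2 * θ) * sin (8 * θ) = (sin (10 * θ) + sin (6 * θ)) / 2 := by
      have := hs 4; norm_num at this ⊢; exact this
    have hc5 : cos (2 * θ) * cos (10 * θ) = (cos (12 * θ) + cos (8 * θ)) / 2 := by
      have := hc 5; norm_num at this ⊢; exact this
    have hs5 : cos (2 * θ) * sin (10 * θ) = (sin (12 * θ) + sin (8 * θ)) / 2 := by
      have := hs 5; norm_num at this ⊢; exact this
    have hc6 : cos (2 * θ) * cos (12 * θ) = (cos (14 * θ) + cos (10 * θ)) / 2 := by
      have := hc 6; norm_num at this ⊢; exact this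
    have hs6 : cos (2 * θ) * sin (12 * θ) = (sin (14 * θ) + sin (10 * θ)) / 2 := by
      have := hs 6; norm_num at this ⊢; exact this
    have hc7 : cos (2 * θ) * cos (14 * θ) = (cos (16 * θ) + cos (12 * θ)) / 2 := by
      have := hc 7; norm_num at this ⊢; exact this
    have hs7 : cos (2 * θ) * sin (14 * θ) = (sin (16 * θ) + sin (12 * θ)) / 2 := by
      have := hs 7; norm_num at this ⊢; exact this
    have hc8 : cos (2 * θ) * cos (16 * θ) = (cos (18 * θ) + cos (14 * θ)) / 2 := by
      have := hc 8; norm_num at this ⊢; exact this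
    have hs8 : cos (2 * θ) * sin (16 * θ) = (sin (18 * θ) + sin (14 * θ)) / 2 := by
      have := hs 8; norm_num at this ⊢; exact this
    norm_num
    -- `hck` and `hsk` carry k * `sinCoeff k` - `cosCoeff k` and -k * `cosCoeff k` - `sinCoeff k`;
    -- the last term comes from 2 cos⁴ θ.
    linear_combination
      141448 / 100000000 * hc1 - 61684866 / 100000000 * hs1 + 13176991 / 100000000 * hc2 -
      848688 / 100000000 * hs2 - 1652317 / 100000000 * hc3 + 1490579 / 100000000 * hs3 + 120211
      / 100000000 * hc4 - 357749 / 100000000 * hs4 + 5790 / 100000000 * hc5 + 63972 / 100000000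
      * hs5 - 4645 / 100000000 * hc6 - 9925 / 100000000 * hs6 + 1255 / 100000000 * hc7 + 1385 /
      100000000 * hs7 - 257 / 100000000 * hc8 - 171 / 100000000 * hs8 - 1 / 2 * hc1
  have hC := fun k : ℝ => abs_le.1 (abs_cos_le_one (k * θ))
  have hS := fun k : ℝ => abs_le.1 (abs_sin_le_one (k * θ))
  rw [key, abs_le]
  have := hC 2; have := hS 2; have := hC 4; have := hS 4; have := hC 6; have := hS 6
  have := hC 8; have := hS 8; have := hC 10; have := hS 10; have := hC 12; have := hS 12
  have := hC 14; have := hS 14; have := hC 16; have := hS 16; have := hC 18; have := hS 18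
  constructor <;> linarith

/-- The periodic difference v attains its extrema. Where its derivative vanishes the residual equals
-2(1 + sin²)v, so |v| is at most half the residual bound. -/
lemma abs_invSq_sub_approx_le (θ : ℝ) : |invSq 0 θ - approx θ| ≤ 3 / 1000000 := by
  set v : ℝ → ℝ := fun θ => invSq 0 θ - approx θ with hv
  have hd : ∀ θ, HasDerivAt v _ θ := fun θ =>
    (hasDerivAt_invSq 0 θ).fun_sub (hasDerivAt_approx θ)
  have hcont : Continuous v := continuous_iff_continuousAt.2 fun θ => (hd θ).continuousAt
  have hper : Function.Periodic v (2 * π) := invSq_zero_periodic.sub approx_periodic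
  have hK := hper.compact_of_continuous (by positivity) hcont
  have hne : (Set.range v).Nonempty := Set.range_nonempty v
  have hcrit : ∀ x, deriv v x = 0 → |v x| ≤ 3 / 1000000 := fun x hx => by
    rw [(hd x).deriv] at hx
    have h1 := one_add_cos_sq_pos x
    have hR := approx_residual x
    have : (1 + cos x ^ 2) * approxDeriv x + 2 * (1 + sin x ^ 2) * approx x
        - 2 * (1 + cos x ^ 4) = -(2 * (1 + sin x ^ 2)) * v x := by
      rw [sub_eq_zero] at hx
      rw [← hx, hv]
      field_simp
      ring
    rw [this, abs_mul, abs_neg, abs_of_pos (by positivity)] at hR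
    nlinarith [sq_nonneg (sin x), abs_nonneg (v x)]
  obtain ⟨_, ⟨x, rfl⟩, hx⟩ := hK.exists_isGreatest hne
  obtain ⟨_, ⟨y, rfl⟩, hy⟩ := hK.exists_isLeast hne
  have hx' : deriv v x = 0 :=
    IsLocalMax.deriv_eq_zero (Filter.Eventually.of_forall fun z => hx ⟨z, rfl⟩)
  have hy' : deriv v y = 0 :=
    IsLocalMin.deriv_eq_zero (Filter.Eventually.of_forall fun z => hy ⟨z, rfl⟩)
  exact abs_le.2 ⟨(abs_le.1 (hcrit y hy')).1.trans (hy ⟨θ, rfl⟩),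
    (hx ⟨θ, rfl⟩ : v θ ≤ v x).trans (abs_le.1 (hcrit x hx')).2⟩

lemma abs_aConst_sub_le : |aConst - 1.19903| ≤ 0.000005 := by
  have h := abs_le.1 (abs_invSq_sub_approx_le 0)
  rw [invSq_zero_zero, approx_zero] at h
  rw [abs_le]
  constructor <;> norm_num at h ⊢ <;> linarith

end Approximation

/-! ### Existence and uniqueness of the periodic orbit -/

section PeriodicOrbits

open Real

section ScalarEquations

variable {g : ℝ → ℝ} {m : ℝ}

lemma hasDerivAt_integral (hg : Continuous g) (x : ℝ) :
    HasDerivAt (fun x => ∫ s in (0 : ℝ)..x, g s) (g x) x :=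
  (hg.integral_hasStrictDerivAt 0 x).hasDerivAt

lemma strictMono_integral (hg : Continuous g) (hm : 0 < m) (h : ∀ x, m ≤ g x) :
    StrictMono fun x => ∫ s in (0 : ℝ)..x, g s :=
  strictMono_of_hasDerivAt_pos (hasDerivAt_integral hg) fun x => hm.trans_le (h x)

lemma surjective_integral (hg : Continuous g) (hm : 0 < m) (h : ∀ x, m ≤ g x) :
    Function.Surjective fun x => ∫ s in (0 : ℝ)..x, g s := by
  have hmono : Monotone fun x => (∫ s in (0 : ℝ)..x, g s) - m * x := by
    have hd := fun x => (hasDerivAt_integral hg x).fun_sub ((hasDerivAt_id' x).const_mul m)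
    refine monotone_of_deriv_nonneg (fun x => (hd x).differentiableAt) fun x => ?_
    rw [(hd x).deriv]
    linarith [h x]
  have hcont : Continuous fun x => ∫ s in (0 : ℝ)..x, g s :=
    continuous_iff_continuousAt.2 fun x => (hasDerivAt_integral hg x).continuousAt
  refine hcont.surjective ?_ ?_
  · refine Filter.tendsto_atTop_mono' _ ?_ (Filter.tendsto_id.const_mul_atTop hm)
    filter_upwards [Filter.eventually_ge_atTop 0] with x hx
    have := hmono hx
    simp at this
    exact this
  · refine Filter.tendsto_atBot_mono' _ ?_ (Filter.tendsto_id.const_mul_atBot hm)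
    filter_upwards [Filter.eventually_le_atBot 0] with x hx
    have := hmono hx
    simp at this
    exact this

/-- The autonomous scalar equation `θ' = -1 / g θ` with `g` bounded below by a positive constant has
a global solution starting at `0`, the inverse of its time function `-∫ g`. -/
lemma exists_angle_solution (hg : Continuous g) (hm : 0 < m) (h : ∀ x, m ≤ g x) :
    ∃ θ : ℝ → ℝ, (∀ t, HasDerivAt θ (-(g (θ t))⁻¹) t) ∧
      (∀ x, θ (-∫ s in (0 : ℝ)..x, g s) = x) ∧ ∀ t, -∫ s in (0 : ℝ)..(θ t), g s = t := by
  set e := (strictMono_integral hg hm h).orderIsoOfSurjective _ (surjective_integral hg hm h)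
    with he
  have he' : ∀ x, e x = ∫ s in (0 : ℝ)..x, g s := fun x => rfl
  have hsymm : ∀ t, HasDerivAt e.symm (g (e.symm t))⁻¹ t := fun t =>
    HasDerivAt.of_local_left_inverse e.symm.continuous.continuousAt
      (hasDerivAt_integral hg (e.symm t)) (hm.trans_le (h _)).ne'
      (Filter.Eventually.of_forall fun y => e.apply_symm_apply y)
  refine ⟨fun t => e.symm (-t), fun t => ?_, fun x => ?_, fun t => ?_⟩
  · have := (hsymm (-t)).scomp t (hasDerivAt_neg' t)
    refine this.congr_deriv ?_
    simp
  · simp only [neg_neg]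
    exact e.symm_apply_apply x
  · rw [← he', e.apply_symm_apply, neg_neg]

/-- Integrating factor. It yields both that f vanishes identically once f 0 = 0 and that f keeps its
sign. -/
lemma eq_mul_exp_integral {f k : ℝ → ℝ} (hk : Continuous k)
    (hf : ∀ t, HasDerivAt f (k t * f t) t) (t : ℝ) :
    f t = f 0 * exp (∫ s in (0 : ℝ)..t, k s) := by
  have hd : ∀ t, HasDerivAt (fun t => f t * exp (-∫ s in (0 : ℝ)..t, k s)) 0 t := fun t =>
    ((hf t).fun_mul (hasDerivAt_integral hk t).fun_neg.exp).congr_deriv (by ring)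
  have := is_const_of_deriv_eq_zero (fun x => (hd x).differentiableAt) (fun x => (hd x).deriv) t 0
  simp only [intervalIntegral.integral_same, neg_zero, exp_zero, mul_one] at this
  rw [← this, mul_assoc, ← exp_add, neg_add_cancel, exp_zero, mul_one]

lemma exists_pos_le_of_periodic {f : ℝ → ℝ} {T : ℝ} (hf : Continuous f) (hp : ∀ x, 0 < f x)
    (hT : T ≠ 0) (hper : Function.Periodic f T) : ∃ m, 0 < m ∧ ∀ x, m ≤ f x := by
  obtain ⟨_, ⟨y, rfl⟩, hy⟩ :=
    (hper.compact_of_continuous hT hf).exists_isLeast (Set.range_nonempty f)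
  exact ⟨f y, hp y, fun x => hy ⟨x, rfl⟩⟩

end ScalarEquations

/-- The vector field of the quintic system. -/
abbrev quinticField : ℝ × ℝ → ℝ × ℝ := polyField quinticP quinticQ

/-- The radial part `r' / r` of the quintic system. -/
def radialRate (x y : ℝ) : ℝ := -(x ^ 2 + 2 * y ^ 2) + x ^ 4 + (x ^ 2 + y ^ 2) ^ 2

/-- The angular velocity of the quintic system. -/
def angularRate (x y : ℝ) : ℝ := -(2 * x ^ 2 + y ^ 2)

lemma quinticField_apply (x y : ℝ) :
    quinticField (x, y) = (radialRate x y * x - angularRate x y * y,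
      radialRate x y * y + angularRate x y * x) := by
  simp only [quinticField, polyField, polyEval, quinticP, quinticQ, radialRate, angularRate,
    map_add, map_sub, map_mul, map_neg, map_pow, MvPolynomial.eval_X, map_ofNat,
    Matrix.cons_val_zero, Matrix.cons_val_one]
  ext <;> ring

lemma radialRate_polar (r θ : ℝ) : radialRate (r * cos θ) (r * sin θ) =
    r ^ 4 * (1 + cos θ ^ 4) - r ^ 2 * (1 + sin θ ^ 2) := by
  have hs : sin θ ^ 2 = 1 - cos θ ^ 2 := sin_sq θ
  simp only [radialRate, mul_pow, hs]
  ring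

lemma angularRate_polar (r θ : ℝ) :
    angularRate (r * cos θ) (r * sin θ) = -(r ^ 2 * (1 + cos θ ^ 2)) := by
  have hs : sin θ ^ 2 = 1 - cos θ ^ 2 := sin_sq θ
  simp only [angularRate, mul_pow, hs]
  ring

/-- The trajectory with `r⁻² = invSq K θ`, parametrized by the polar angle. -/
def polarTrajectory (K θ : ℝ) : ℝ × ℝ :=
  ((√(invSq K θ))⁻¹ * cos θ, (√(invSq K θ))⁻¹ * sin θ)

/-- The scalar factor is dt/dθ, the reciprocal of the angular velocity -(1 + cos² θ) / `invSq K θ`.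
-/
lemma hasDerivAt_polarTrajectory {K θ : ℝ} (h : 0 < invSq K θ) :
    HasDerivAt (polarTrajectory K)
      (-(invSq K θ / (1 + cos θ ^ 2)) • quinticField (polarTrajectory K θ)) θ := by
  have hs := sqrt_pos.2 h
  have hsq : √(invSq K θ) ^ 2 = invSq K θ := sq_sqrt h.le
  have hr := ((hasDerivAt_invSq K θ).sqrt h.ne').fun_inv hs.ne'
  refine ((hr.fun_mul (hasDerivAt_cos θ)).prodMk (hr.fun_mul (hasDerivAt_sin θ))).congr_deriv ?_
  have h1 := one_add_cos_sq_pos θ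
  rw [polarTrajectory, quinticField_apply, Prod.smul_mk, radialRate_polar, angularRate_polar]
  simp only [smul_eq_mul]
  rw [← hsq, sqrt_sq hs.le]
  generalize √(invSq K θ) = w at *
  ext
  · simp only
    field_simp
    ring
  · simp only
    field_simp
    ring

lemma polarTrajectory_eq (θ : ℝ) :
    polarTrajectory 0 θ = (radius θ * cos θ, radius θ * sin θ) := by
  rw [polarTrajectory, radius_eq]

lemma polarCurve_radius : polarCurve radius = Set.range (polarTrajectory 0) := by
  rw [polarCurve]
  congr 1
  ext1 θ
  rw [polarTrajectory_eq]

lemma polarTrajectory_zero_periodic : Function.Periodic (polarTrajectory 0) (2 * π) := fun θ => by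
  rw [polarTrajectory, invSq_zero_periodic, sin_add_two_pi, cos_add_two_pi, polarTrajectory]

lemma isPeriodicOrbit_polarCurve : IsPeriodicOrbit quinticField (polarCurve radius) := by
  set g : ℝ → ℝ := fun θ => invSq 0 θ / (1 + cos θ ^ 2) with hgdef
  have hg : Continuous g :=
    (continuous_invSq 0).div (by fun_prop) fun θ => (one_add_cos_sq_pos θ).ne'
  have hpos : ∀ θ, 0 < g θ := fun θ => div_pos (invSq_zero_pos θ) (one_add_cos_sq_pos θ)
  have hper : Function.Periodic g (2 * π) := fun θ => by
    simp only [hgdef, invSq_zero_periodic θ, cos_add_two_pi]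
  obtain ⟨m, hm, hmg⟩ := exists_pos_le_of_periodic hg hpos (by positivity) hper
  obtain ⟨θ, hθ, hinv, hinv'⟩ := exists_angle_solution hg hm hmg
  -- The integral of g over a turn is the period: after it the angle has dropped by 2π.
  have hT : ∀ t, θ (t + ∫ s in (0 : ℝ)..(2 * π), g s) = θ t - 2 * π := fun t => by
    rw [← hinv (θ t - 2 * π)]
    congr 1
    have hi := fun a b => hg.intervalIntegrable (μ := MeasureTheory.volume) a b
    have h1 := hper.intervalIntegral_add_eq (θ t - 2 * π) 0
    rw [sub_add_cancel, zero_add] at h1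
    have h2 := intervalIntegral.integral_add_adjacent_intervals (hi 0 (θ t - 2 * π)) (hi _ (θ t))
    linarith [hinv' t]
  have hsurj : Function.Surjective θ := fun x => ⟨_, hinv x⟩
  refine ⟨fun t => polarTrajectory 0 (θ t), ∫ s in (0 : ℝ)..(2 * π), g s, fun t => ?_, ?_,
    fun t => ?_, ?_, ?_⟩
  · refine ((hasDerivAt_polarTrajectory (invSq_zero_pos (θ t))).scomp t (hθ t)).congr_deriv ?_
    have := (hpos (θ t)).ne'
    rw [smul_smul, neg_mul_neg, inv_mul_cancel₀ this, one_smul]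
  · exact intervalIntegral.intervalIntegral_pos_of_pos (hg.intervalIntegrable _ _) hpos
      (by positivity)
  · simp only [hT, polarTrajectory_zero_periodic.sub_eq]
  · obtain ⟨t, ht⟩ := hsurj π
    have h0 : θ 0 = 0 := by simpa using hinv 0
    refine ⟨t, fun h => ?_⟩
    simp only [ht, h0, polarTrajectory_eq, Prod.mk.injEq, cos_pi, cos_zero] at h
    linarith [h.1, radius_pos 0, radius_pos π]
  · rw [polarCurve_radius]
    exact (hsurj.range_comp (polarTrajectory 0)).symm

/-- Polar coordinates along a solution that avoids the origin. -/
lemma exists_polar_lift {x y : ℝ → ℝ}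
    (hx : ∀ t, HasDerivAt x (radialRate (x t) (y t) * x t - angularRate (x t) (y t) * y t) t)
    (hy : ∀ t, HasDerivAt y (radialRate (x t) (y t) * y t + angularRate (x t) (y t) * x t) t)
    (hne : ∃ t, (x t, y t) ≠ 0) :
    ∃ (θ₀ : ℝ) (θ r : ℝ → ℝ), (∀ t, θ t = θ₀ - ∫ s in (0 : ℝ)..t, -angularRate (x s) (y s)) ∧
      (∀ t, HasDerivAt θ (angularRate (x t) (y t)) t) ∧
      (∀ t, HasDerivAt r (radialRate (x t) (y t) * r t) t) ∧ (∀ t, 0 < r t) ∧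
      ∀ t, x t = r t * cos (θ t) ∧ y t = r t * sin (θ t) := by
  have hxc : Continuous x := continuous_iff_continuousAt.2 fun t => (hx t).continuousAt
  have hyc : Continuous y := continuous_iff_continuousAt.2 fun t => (hy t).continuousAt
  have hrad : Continuous fun t => radialRate (x t) (y t) := by unfold radialRate; fun_prop
  have hang : Continuous fun t => -angularRate (x t) (y t) := by unfold angularRate; fun_prop
  set z : ℂ := ⟨x 0, y 0⟩ with hz
  set θ : ℝ → ℝ := fun t => z.arg - ∫ s in (0 : ℝ)..t, -angularRate (x s) (y s) with hθ
  have hθ' : ∀ t, HasDerivAt θ (angularRate (x t) (y t)) t := fun t =>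
    ((hasDerivAt_integral hang t).const_sub _).congr_deriv (neg_neg _)
  set r : ℝ → ℝ := fun t => x t * cos (θ t) + y t * sin (θ t) with hr
  have hr' : ∀ t, HasDerivAt r (radialRate (x t) (y t) * r t) t := fun t =>
    (((hx t).fun_mul (hθ' t).cos).fun_add ((hy t).fun_mul (hθ' t).sin)).congr_deriv (by
      simp only [hr]; ring)
  -- The component of (x, y) orthogonal to the direction θ solves a homogeneous linear equation and
  -- starts at 0, so it vanishes and r is the signed radius.
  have hb' : ∀ t, HasDerivAt (fun t => y t * cos (θ t) - x t * sin (θ t))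
      (radialRate (x t) (y t) * (y t * cos (θ t) - x t * sin (θ t))) t := fun t =>
    (((hy t).fun_mul (hθ' t).cos).fun_sub ((hx t).fun_mul (hθ' t).sin)).congr_deriv (by ring)
  have hθ0 : θ 0 = z.arg := by simp [hθ]
  have hx0 : x 0 = ‖z‖ * cos (θ 0) := by rw [hθ0, Complex.norm_mul_cos_arg]
  have hy0 : y 0 = ‖z‖ * sin (θ 0) := by rw [hθ0, Complex.norm_mul_sin_arg]
  have hb : ∀ t, y t * cos (θ t) - x t * sin (θ t) = 0 := fun t => by
    rw [eq_mul_exp_integral hrad hb' t, hx0, hy0]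
    ring
  have hr0 : r 0 = ‖z‖ := by
    simp only [hr]
    rw [hx0, hy0]
    linear_combination ‖z‖ * sin_sq_add_cos_sq (θ 0)
  have hxr : ∀ t, x t = r t * cos (θ t) := fun t => by
    simp only [hr]
    linear_combination (-x t) * sin_sq_add_cos_sq (θ t) - sin (θ t) * hb t
  have hyr : ∀ t, y t = r t * sin (θ t) := fun t => by
    simp only [hr]
    linear_combination (-y t) * sin_sq_add_cos_sq (θ t) + cos (θ t) * hb t
  have hrexp := eq_mul_exp_integral hrad hr'
  have hrpos : 0 < r 0 := by
    rw [hr0]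
    refine norm_pos_iff.2 fun h0 => ?_
    obtain ⟨t, ht⟩ := hne
    rw [h0, norm_zero] at hr0
    refine ht ?_
    rw [hxr, hyr, hrexp t, hr0]
    simp
  exact ⟨z.arg, θ, r, fun _ => rfl, hθ', hr', fun t => by
    rw [hrexp t]; exact mul_pos hrpos (exp_pos _), fun t => ⟨hxr t, hyr t⟩⟩

lemma eq_polarCurve_of_isPeriodicOrbit {Γ : Set (ℝ × ℝ)} (h : IsPeriodicOrbit quinticField Γ) :
    Γ = polarCurve radius := by
  obtain ⟨γ, T, hγ, hT, hper, ⟨t₁, ht₁⟩, rfl⟩ := h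
  set x : ℝ → ℝ := fun t => (γ t).1 with hxdef
  set y : ℝ → ℝ := fun t => (γ t).2 with hydef
  have hd : ∀ t, HasDerivAt γ (radialRate (x t) (y t) * x t - angularRate (x t) (y t) * y t,
      radialRate (x t) (y t) * y t + angularRate (x t) (y t) * x t) t := fun t => by
    rw [← quinticField_apply]; exact hγ t
  have hx : ∀ t, HasDerivAt x (radialRate (x t) (y t) * x t - angularRate (x t) (y t) * y t) t :=
    fun t => (hd t).fst
  have hy : ∀ t, HasDerivAt y (radialRate (x t) (y t) * y t + angularRate (x t) (y t) * x t) t :=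
    fun t => (hd t).snd
  have hne : ∃ t, (x t, y t) ≠ 0 := by
    by_contra! h0
    exact ht₁ ((h0 t₁).trans (h0 0).symm)
  obtain ⟨θ₀, θ, r, hθ, hθ', hr', hr, hxy⟩ := exists_polar_lift hx hy hne
  have hxc : Continuous x := continuous_iff_continuousAt.2 fun t => (hx t).continuousAt
  have hyc : Continuous y := continuous_iff_continuousAt.2 fun t => (hy t).continuousAt
  have hang : Continuous fun t => -angularRate (x t) (y t) := by unfold angularRate; fun_prop
  have hkc : Continuous fun t => 2 * (x t ^ 2 + 2 * y t ^ 2) := by fun_prop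
  have hrsq : ∀ t, x t ^ 2 + y t ^ 2 = r t ^ 2 := fun t => by
    rw [(hxy t).1, (hxy t).2]
    linear_combination r t ^ 2 * sin_sq_add_cos_sq (θ t)
  set v : ℝ → ℝ := fun t => (r t ^ 2)⁻¹ - invSq 0 (θ t) with hvdef
  have hv : ∀ t, HasDerivAt v (2 * (x t ^ 2 + 2 * y t ^ 2) * v t) t := fun t => by
    have hrt := (hr t).ne'
    refine ((((hr' t).fun_pow 2).fun_inv (by positivity)).fun_sub
      ((hasDerivAt_invSq 0 (θ t)).comp t (hθ' t))).congr_deriv ?_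
    have h1 := one_add_cos_sq_pos (θ t)
    have hs := sin_sq (θ t)
    simp only [hvdef]
    rw [(hxy t).1, (hxy t).2, radialRate_polar, angularRate_polar]
    generalize invSq 0 (θ t) = P
    rw [show (r t * cos (θ t)) ^ 2 + 2 * (r t * sin (θ t)) ^ 2 = r t ^ 2 * (1 + sin (θ t) ^ 2) by
      rw [mul_pow, mul_pow, hs]; ring]
    field_simp
    ring
  have hv_eq := eq_mul_exp_integral hkc hv
  -- Equal points have angles that differ by a multiple of 2π, which `invSq 0` does not see.
  have hvT : v T = v 0 := by
    have hγT : γ T = γ 0 := by simpa using hper 0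
    have hxT : x T = x 0 := by simp only [hxdef, hγT]
    have hyT : y T = y 0 := by simp only [hydef, hγT]
    have hrT : r T = r 0 := by
      rw [← sq_eq_sq₀ (hr T).le (hr 0).le, ← hrsq, ← hrsq, hxT, hyT]
    have h1 := hxy T
    rw [hxT, hyT, hrT, (hxy 0).1, (hxy 0).2] at h1
    have hcos := mul_left_cancel₀ (hr 0).ne' h1.1
    have hsin := mul_left_cancel₀ (hr 0).ne' h1.2
    obtain ⟨k, hk⟩ := Real.Angle.angle_eq_iff_two_pi_dvd_sub.1
      (Real.Angle.cos_sin_inj hcos.symm hsin.symm)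
    have : θ T = θ 0 + k * (2 * π) := by linarith
    simp only [hvdef, hrT, this, invSq_zero_periodic.int_mul k (θ 0)]
  have hv0 : v 0 = 0 := by
    have hpos : 0 < ∫ s in (0 : ℝ)..T, 2 * (x s ^ 2 + 2 * y s ^ 2) :=
      intervalIntegral.intervalIntegral_pos_of_pos (hkc.intervalIntegrable _ _) (fun t => by
        have := hrsq t
        have := hr t
        nlinarith [sq_nonneg (y t)]) hT
    have h1 := hv_eq T
    rw [hvT] at h1
    have h2 := one_lt_exp_iff.2 hpos
    by_contra h3
    exact h2.ne' (mul_left_cancel₀ h3 (by rw [← h1, mul_one]))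
  have hrad : ∀ t, r t = radius (θ t) := fun t => by
    have h1 : (r t ^ 2)⁻¹ = invSq 0 (θ t) := by
      have := hv_eq t
      rw [hv0, zero_mul] at this
      exact sub_eq_zero.1 this
    rw [radius_eq, ← h1, sqrt_inv, sqrt_sq (hr t).le, inv_inv]
  have hγθ : ∀ t, γ t = polarTrajectory 0 (θ t) := fun t => by
    rw [polarTrajectory_eq, ← hrad]
    exact Prod.ext (hxy t).1 (hxy t).2
  -- By periodicity the angular speed is bounded away from 0, so the angle takes every value and the
  -- orbit covers the whole curve.
  obtain ⟨m, hm, hmr⟩ := exists_pos_le_of_periodic (f := fun t => -angularRate (x t) (y t)) hang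
    (fun t => by
      have := hrsq t
      have := hr t
      unfold angularRate
      nlinarith [sq_nonneg (x t)]) hT.ne' (fun t => by simp only [hxdef, hydef, hper t])
  have hsurj : Function.Surjective θ := fun a => by
    obtain ⟨t, ht⟩ := surjective_integral hang hm hmr (θ₀ - a)
    refine ⟨t, ?_⟩
    simp only at ht
    rw [hθ, ht]
    ring
  rw [polarCurve_radius, ← hsurj.range_comp (polarTrajectory 0)]
  exact congrArg Set.range (funext hγθ)

lemma isLimitCycle_iff (Γ : Set (ℝ × ℝ)) :
    IsLimitCycle quinticField Γ ↔ Γ = polarCurve radius := by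
  refine ⟨fun h => eq_polarCurve_of_isPeriodicOrbit h.1, ?_⟩
  rintro rfl
  exact ⟨isPeriodicOrbit_polarCurve, Set.univ, isOpen_univ, Set.subset_univ _,
    fun Γ' h _ => eq_polarCurve_of_isPeriodicOrbit h⟩

end PeriodicOrbits

/-! ### The return map and its multiplier -/

section Hyperbolicity

open Real

lemma radius_zero_sq_inv : (radius 0 ^ 2)⁻¹ = aConst := by
  rw [radius_eq, invSq_zero_zero, inv_pow, inv_inv, sq_sqrt]
  rw [← invSq_zero_zero]
  exact (invSq_zero_pos 0).le

/-- The parameter `K` of the solution `invSq K` that starts at `(radius 0 + s, 0)`. -/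
def initialParam (s : ℝ) : ℝ := ((radius 0 + s) ^ 2)⁻¹ - aConst

/-- The return map of the positive half-axis, in the coordinate centred at the limit cycle. -/
def returnMap (s : ℝ) : ℝ := (√(aConst + growth * initialParam s))⁻¹ - radius 0

lemma initialParam_zero : initialParam 0 = 0 := by
  rw [initialParam, add_zero, radius_zero_sq_inv, sub_self]

lemma returnMap_zero : returnMap 0 = 0 := by
  rw [returnMap, initialParam_zero, radius_eq, invSq_zero_zero]
  simp

lemma hasDerivAt_initialParam : HasDerivAt initialParam (-2 / radius 0 ^ 3) 0 := by
  have hr := radius_pos 0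
  have h := ((((hasDerivAt_id' (0 : ℝ)).const_add (radius 0)).fun_pow 2).fun_inv
    (by positivity)).sub_const aConst
  refine h.congr_deriv ?_
  simp only [add_zero]
  field_simp
  norm_num
  ring

/-- The substitution s ↦ (`radius 0` + s)⁻² conjugates the map to u ↦ a + `growth` (u - a), and
conjugation preserves the derivative at a fixed point. -/
lemma hasDerivAt_returnMap : HasDerivAt returnMap growth 0 := by
  have hr := radius_pos 0
  have ha : aConst + growth * initialParam 0 = (radius 0 ^ 2)⁻¹ := by
    rw [initialParam_zero, radius_zero_sq_inv]; ring
  have hs : √(aConst + growth * initialParam 0) = (radius 0)⁻¹ := by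
    rw [ha, sqrt_inv, sqrt_sq hr.le]
  have h := ((((hasDerivAt_initialParam.const_mul growth).const_add aConst).sqrt
    (by rw [ha]; positivity)).fun_inv (by rw [hs]; positivity)).sub_const (radius 0)
  refine h.congr_deriv ?_
  rw [hs]
  field_simp

lemma radicand_neg_two_pi : growth * radicand (-(2 * π)) = aConst := by
  rw [← radicand_add_two_pi, neg_add_cancel]
  simp [radicand]

lemma decay_neg_two_pi : decay (-(2 * π)) = growth := by
  have h := decay_add_two_pi (-(2 * π))
  have := growth_pos.ne'
  rw [neg_add_cancel, decay_zero] at h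
  field_simp at h
  exact h.symm

/-- A trajectory `invSq K` that stays positive over a turn is run through by a solution of the
system, for the polar angle decreasing from `0` to `-2π`. -/
lemma exists_solution_one_turn {K : ℝ} (hK : 0 < radicand (-(2 * π)) + K) :
    ∃ (θ : ℝ → ℝ) (τ : ℝ), 0 < τ ∧ θ 0 = 0 ∧ θ τ = -(2 * π) ∧
      (∀ t ∈ Set.Ioo 0 τ, -(2 * π) < θ t ∧ θ t < 0 ∧ 0 < invSq K (θ t)) ∧
      IsIntegralCurveOn (fun t => polarTrajectory K (θ t)) (fun _ => quinticField)
        (Set.Icc 0 τ) := by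
  have hpos : ∀ x, -(2 * π) ≤ x → 0 < invSq K x := fun x hx =>
    mul_pos (hK.trans_le (by gcongr; exact radicand_strictMono.monotone hx)) (decay_pos x)
  obtain ⟨x₀, hx₀, hmin⟩ := isCompact_Icc.exists_isMinOn
    (Set.nonempty_Icc.2 (show -(2 * π) ≤ 0 by linarith [pi_pos])) (continuous_invSq K).continuousOn
  set m := invSq K x₀ with hm
  have hm0 : 0 < m := hpos x₀ hx₀.1
  -- Truncating below at the minimum m over [-2π, 0] makes the time function global without changing
  -- it on that interval.
  set g : ℝ → ℝ := fun x => max (invSq K x) m / (1 + cos x ^ 2) with hg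
  have hgc : Continuous g :=
    ((continuous_invSq K).max continuous_const).div (by fun_prop)
      fun x => (one_add_cos_sq_pos x).ne'
  have hgm : ∀ x, m / 2 ≤ g x := fun x => by
    have := cos_sq_le_one x
    exact div_le_div₀ (hm0.le.trans (le_max_right _ _)) (le_max_right _ _)
      (one_add_cos_sq_pos x) (by linarith)
  have hm2 : 0 < m / 2 := by positivity
  obtain ⟨θ, hθ, hinv, hinv'⟩ := exists_angle_solution hgc hm2 hgm
  have hmono := strictMono_integral hgc hm2 hgm
  set τ := -∫ s in (0 : ℝ)..(-(2 * π)), g s with hτ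
  have h0 : θ 0 = 0 := by simpa using hinv 0
  have hθτ : θ τ = -(2 * π) := hinv _
  have hanti : StrictAnti θ := fun s t hst => by
    rw [← hmono.lt_iff_lt]
    linarith [hinv' s, hinv' t]
  have hτ0 : 0 < τ := by
    rw [← hanti.lt_iff_gt, h0, hθτ]
    linarith [pi_pos]
  refine ⟨θ, τ, hτ0, h0, hθτ, fun t ht => ?_, fun t ht => ?_⟩
  · have h1 : -(2 * π) < θ t := hθτ ▸ hanti ht.2
    exact ⟨h1, h0 ▸ hanti ht.1, hpos _ h1.le⟩
  · have h1 : -(2 * π) ≤ θ t := hθτ ▸ hanti.antitone ht.2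
    have h2 : θ t ≤ 0 := h0 ▸ hanti.antitone ht.1
    have hp := hpos _ h1
    refine ((hasDerivAt_polarTrajectory hp).scomp t (hθ t)).congr_deriv ?_ |>.hasDerivWithinAt
    have hmt : m ≤ invSq K (θ t) := hmin ⟨h1, h2⟩
    have hgt : g (θ t) = invSq K (θ t) / (1 + cos (θ t) ^ 2) := by
      simp only [hg, max_eq_left hmt]
    have : g (θ t) ≠ 0 := (hm2.trans_le (hgm _)).ne'
    rw [← hgt, smul_smul, neg_mul_neg, inv_mul_cancel₀ this, one_smul]

lemma isReturnMap_returnMap : ∃ ε, 0 < ε ∧ ε ≤ radius 0 ∧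
    IsReturnMap quinticField (radius 0, 0) (1, 0) (radius 0) ε returnMap := by
  have hr := radius_pos 0
  have hev : ∀ᶠ s in nhds (0 : ℝ), |returnMap s| < radius 0 ∧
      0 < radicand (-(2 * π)) + initialParam s := by
    refine (hasDerivAt_returnMap.continuousAt.abs.eventually_lt continuousAt_const ?_).and
      (continuousAt_const.eventually_lt
        (hasDerivAt_initialParam.continuousAt.const_add _) ?_)
    · rw [returnMap_zero, abs_zero]; exact hr
    · rw [initialParam_zero, add_zero]; exact radicand_pos _
  obtain ⟨ε, hε, hball⟩ := Metric.eventually_nhds_iff.1 hev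
  refine ⟨min ε (radius 0), lt_min hε hr, min_le_right _ _, fun u hu => ?_, fun s hs => ?_⟩
  · have hu' : 0 < radius 0 + u := by linarith [(abs_lt.1 hu).1]
    rw [LinearIndependent.pair_iff]
    intro α β h
    rw [Prod.smul_mk, Prod.mk_add_mk, quinticField_apply] at h
    simp only [radialRate, angularRate, smul_eq_mul, Prod.smul_mk, Prod.mk_add_mk, Prod.mk_eq_zero,
      mul_one, mul_zero, add_zero, zero_add] at h
    have hβ : β = 0 := by
      have h2 := h.2
      have : β * (radius 0 + u) ^ 3 = 0 := by linear_combination (-1 / 2) * h2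
      exact (mul_eq_zero.1 this).resolve_right (by positivity)
    subst hβ
    simpa using h.1
  · obtain ⟨hret, hK⟩ := hball (show dist s 0 < ε by
      rw [dist_zero_right]; exact hs.trans_le (min_le_left _ _))
    have hs' : 0 < radius 0 + s := by
      linarith [(abs_lt.1 (hs.trans_le (min_le_right _ _))).1]
    obtain ⟨θ, τ, hτ, h0, hθτ, hmem, hcurve⟩ := exists_solution_one_turn hK
    refine ⟨hret, _, τ, hτ, hcurve, ?_, ?_, fun t ht u hu h => ?_⟩
    · have : invSq (initialParam s) 0 = ((radius 0 + s) ^ 2)⁻¹ := by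
        rw [invSq_eq, invSq_zero_zero, decay_zero, initialParam]; ring
      simp [polarTrajectory, h0, this, sqrt_inv, sqrt_sq hs'.le]
    · have : invSq (initialParam s) (-(2 * π)) = aConst + growth * initialParam s := by
        rw [invSq, decay_neg_two_pi, ← radicand_neg_two_pi]; ring
      simp [polarTrajectory, hθτ, this, returnMap]
    -- An earlier hit of the segment would need sin = 0 and cos > 0, hence an angle in 2πℤ strictly
    -- between -2π and 0.
    · obtain ⟨h1, h2, h3⟩ := hmem t ht
      have hρ : 0 < (√(invSq (initialParam s) (θ t)))⁻¹ := inv_pos.2 (sqrt_pos.2 h3)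
      simp only [polarTrajectory, Prod.smul_mk, Prod.mk_add_mk, Prod.mk.injEq, smul_eq_mul,
        mul_one, mul_zero, add_zero] at h
      have hsin : sin (θ t) = 0 := (mul_eq_zero.1 h.2).resolve_left hρ.ne'
      have hcos : 0 < cos (θ t) :=
        pos_of_mul_pos_right (a := (√(invSq (initialParam s) (θ t)))⁻¹)
          (by rw [h.1]; linarith [(abs_lt.1 hu).1]) hρ.le
      have hcos1 : cos (θ t) = 1 := by
        have := sin_sq_add_cos_sq (θ t)
        rw [hsin] at this
        nlinarith
      exact h2.ne ((cos_eq_one_iff_of_lt_of_lt h1 (by linarith)).1 hcos1)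

lemma isHyperbolic_polarCurve : IsHyperbolic quinticField (polarCurve radius) := by
  obtain ⟨ε, hε, hεr, hret⟩ := isReturnMap_returnMap
  refine ⟨isPeriodicOrbit_polarCurve, (radius 0, 0), ⟨0, by simp⟩, (1, 0), radius 0, ε, returnMap,
    growth, hε, hεr, hret, returnMap_zero, hasDerivAt_returnMap, ?_⟩
  rw [abs_of_pos growth_pos]
  exact one_lt_growth.ne'

end Hyperbolicity

/-! ### Algebraic solutions of linear equations reduce to rational ones -/

section RationalSolutions

open Polynomial Polynomial.Bivariate

section RationalSolution

variable {α β M : ℝ[X]} {q : ℝ → ℝ}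

/-- Coefficientwise differentiation of a bivariate polynomial. -/
def coeffDeriv (G : ℝ[X][Y]) : ℝ[X][Y] :=
  ∑ k ∈ G.support, monomial k (derivative (G.coeff k))

lemma coeff_coeffDeriv (G : ℝ[X][Y]) (k : ℕ) :
    (coeffDeriv G).coeff k = derivative (G.coeff k) := by
  simp +contextual [coeffDeriv, finsetSum_coeff, coeff_monomial]

lemma hasDerivAt_evalEval {q' t : ℝ} (hq : HasDerivAt q q' t) (G : ℝ[X][Y]) :
    HasDerivAt (fun t => G.evalEval t (q t))
      ((coeffDeriv G).evalEval t (q t) + (derivative G).evalEval t (q t) * q') t := by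
  induction G using Polynomial.induction_on' with
  | add G H hG hH =>
    have h : coeffDeriv (G + H) = coeffDeriv G + coeffDeriv H := by
      ext1 k
      simp [coeff_coeffDeriv]
    simp only [h, derivative_add, evalEval_add]
    exact (hG.fun_add hH).congr_deriv (by ring)
  | monomial n a =>
    have h : coeffDeriv (monomial n a) = monomial n (derivative a) := by
      ext1 k
      rw [coeff_coeffDeriv, coeff_monomial, coeff_monomial]
      split_ifs <;> simp
    have he : ∀ (n : ℕ) (a : ℝ[X]) (t y : ℝ), (monomial n a).evalEval t y = a.eval t * y ^ n :=
      fun n a t y => by simp [evalEval, eval_monomial]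
    simp only [h, derivative_monomial, he]
    refine ((a.hasDerivAt t).fun_mul (hq.fun_pow n)).congr_deriv ?_
    simp
    ring

/-- Differentiation along the equation `M q' = β + α q`. -/
def linearDeriv (α β M : ℝ[X]) (G : ℝ[X][Y]) : ℝ[X][Y] :=
  C M * coeffDeriv G + derivative G * (C β + C α * Y)

lemma coeff_linearDeriv (G : ℝ[X][Y]) (k : ℕ) :
    (linearDeriv α β M G).coeff k = M * derivative (G.coeff k) + k * α * G.coeff k +
      (k + 1) * β * G.coeff (k + 1) := by
  have h : derivative G * (C β + C α * Y) = C β * derivative G + C α * (derivative G * Y) := by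
    ring
  rw [linearDeriv, h]
  cases k with
  | zero =>
    simp [coeff_coeffDeriv, coeff_derivative]
  | succ k =>
    simp only [coeff_add, coeff_C_mul, coeff_coeffDeriv, coeff_derivative, coeff_mul_X]
    push_cast
    ring

lemma evalEval_linearDeriv_eq_zero (hM : ∀ t, M.eval t ≠ 0)
    (hq : ∀ t, HasDerivAt q ((β.eval t + α.eval t * q t) / M.eval t) t) {G : ℝ[X][Y]}
    (hG : ∀ t, G.evalEval t (q t) = 0) (t : ℝ) :
    (linearDeriv α β M G).evalEval t (q t) = 0 := by
  have h := hasDerivAt_evalEval (hq t) G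
  simp only [hG] at h
  have h0 := h.unique (hasDerivAt_const t 0)
  have hMt := hM t
  simp only [linearDeriv, evalEval_add, evalEval_mul, evalEval_C, evalEval_X]
  field_simp at h0
  linear_combination h0

/-- If a solution of a linear first-order equation with polynomial coefficients is algebraic, then
the equation has a rational solution, here written `U / W`. -/
lemma exists_rational_solution (hM : ∀ t, M.eval t ≠ 0)
    (hq : ∀ t, HasDerivAt q ((β.eval t + α.eval t * q t) / M.eval t) t)
    (h : ∃ G : ℝ[X][Y], G ≠ 0 ∧ ∀ t, G.evalEval t (q t) = 0) :
    ∃ U W : ℝ[X], W ≠ 0 ∧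
      M * (derivative U * W - U * derivative W) = β * W ^ 2 + α * U * W := by
  classical
  have hex : ∃ n, ∃ G : ℝ[X][Y], G.natDegree = n ∧ G ≠ 0 ∧ ∀ t, G.evalEval t (q t) = 0 := by
    obtain ⟨G, hG⟩ := h
    exact ⟨_, G, rfl, hG⟩
  obtain ⟨G, hdeg, hG0, hG⟩ := Nat.find_spec hex
  have hmin : ∀ H : ℝ[X][Y], H.natDegree < Nat.find hex → (∀ t, H.evalEval t (q t) = 0) → H = 0 :=
    fun H hH hH' => by
      by_contra h0
      exact Nat.find_min hex hH ⟨H, rfl, h0, hH'⟩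
  rw [← hdeg] at hmin
  obtain ⟨N, hN⟩ : ∃ N, G.natDegree = N + 1 := by
    refine Nat.exists_eq_succ_of_ne_zero fun h0 => hG0 ?_
    rw [eq_C_of_natDegree_eq_zero h0] at hG ⊢
    simp only [evalEval_C] at hG
    rw [Polynomial.funext (p := G.coeff 0) (q := 0) (by simpa using hG), C_0]
  set L := G.coeff (N + 1) with hL
  have hL0 : L ≠ 0 := by
    rw [hL, ← hN]
    exact leadingCoeff_ne_zero.2 hG0
  set E := linearDeriv α β M G with hE
  -- E also vanishes along q, and H cancels its top coefficient, so minimality of the degree of G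
  -- forces H = 0.
  set H := C L * E - C (E.coeff (N + 1)) * G with hH
  have hH0 : H = 0 := by
    refine hmin H ?_ fun t => ?_
    · rw [hN, Nat.lt_succ_iff, natDegree_le_iff_coeff_eq_zero]
      intro k hk
      simp only [hH, coeff_sub, coeff_C_mul]
      rcases (Nat.succ_le_iff.2 hk).eq_or_lt with rfl | hk'
      · simp only [Nat.succ_eq_add_one, ← hL]; ring
      · have h1 : G.coeff k = 0 := coeff_eq_zero_of_natDegree_lt (by omega)
        have h2 : G.coeff (k + 1) = 0 := coeff_eq_zero_of_natDegree_lt (by omega)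
        rw [hE, coeff_linearDeriv, h1, h2]
        simp
    · simp only [hH, evalEval_sub, evalEval_mul, hG, hE, evalEval_linearDeriv_eq_zero hM hq hG]
      simp
  have hcoeff : H.coeff N = 0 := by rw [hH0, coeff_zero]
  have hG2 : G.coeff (N + 1 + 1) = 0 := coeff_eq_zero_of_natDegree_lt (by omega)
  simp only [hH, coeff_sub, coeff_C_mul, hE, coeff_linearDeriv, hG2, ← hL] at hcoeff
  -- This quotient is the mean of the roots of G; the coefficient of degree N in H = 0 is the
  -- equation for it.
  refine ⟨-G.coeff N, ((N + 1 : ℕ) : ℝ[X]) * L,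
    mul_ne_zero (by exact_mod_cast N.succ_ne_zero) hL0, ?_⟩
  simp only [derivative_neg, derivative_mul, derivative_natCast]
  push_cast at hcoeff ⊢
  linear_combination (-(N : ℝ[X]) - 1) * hcoeff

end RationalSolution

/-! ### Poles and degree of a rational solution -/

section NoRationalSolution

/-- The leading coefficient of the equation `(2 + t²)(1 + t²) q' = β + α q` satisfied by `q = x⁻²` along a
trajectory of the quintic system, in the chart `y = t x`. -/
def coeffM (R : Type*) [CommRing R] : R[X] := X ^ 4 + 3 * X ^ 2 + 2

/-- The linear coefficient of the equation of `coeffM`. -/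
def coeffα (R : Type*) [CommRing R] : R[X] := 2 * X ^ 3 - 4 * X ^ 2 + 4 * X - 2

/-- The inhomogeneity of the equation of `coeffM`. -/
def coeffβ (R : Type*) [CommRing R] : R[X] := 2 * X ^ 4 + 4 * X ^ 2 + 4

/-- A rational solution has no poles. -/
lemma denominator_natDegree_eq_zero {U W : ℂ[X]} (hW : W ≠ 0) (hc : IsCoprime U W)
    (h : coeffM ℂ * (derivative U * W - U * derivative W) =
      coeffβ ℂ * W ^ 2 + coeffα ℂ * U * W) : W.natDegree = 0 := by
  by_contra hdeg
  obtain ⟨z, hz⟩ := Complex.exists_root (f := W) (natDegree_pos_iff_degree_pos.1 (by omega))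
  obtain ⟨V, hV, hVz⟩ := exists_eq_pow_rootMultiplicity_mul_and_not_dvd W hW z
  obtain ⟨k, hk⟩ := Nat.exists_eq_succ_of_ne_zero ((rootMultiplicity_pos hW).2 hz).ne'
  rw [hk] at hV
  rw [dvd_iff_isRoot, IsRoot.def] at hVz
  have hUz : U.eval z ≠ 0 := fun h0 => by
    obtain ⟨a, b, hab⟩ := hc
    have := congrArg (eval z) hab
    rw [eval_add, eval_mul, eval_mul, h0, hz.eq_zero] at this
    simp at this
  set p : ℂ[X] := X - C z with hp
  have hp0 : p ≠ 0 := X_sub_C_ne_zero z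
  have hpz : p.eval z = 0 := by simp [hp]
  have hdp : derivative p = 1 := by simp [hp]
  have hW' : derivative W = (k + 1) * p ^ k * V + p ^ (k + 1) * derivative V := by
    rw [hV, derivative_mul, derivative_pow, hdp]
    simp
  have h1 : coeffM ℂ * (derivative U * p * V - (k + 1) * U * V - U * p * derivative V) =
      coeffβ ℂ * p ^ (k + 2) * V ^ 2 + coeffα ℂ * U * p * V := by
    refine mul_left_cancel₀ (pow_ne_zero k hp0) ?_
    rw [hW', hV] at h
    simp only [Nat.succ_eq_add_one] at h
    linear_combination h
  have hk1 : (k : ℂ) + 1 ≠ 0 := Nat.cast_add_one_ne_zero k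
  -- At a pole of order k + 1 the most singular term is -(k + 1) M U V, so the pole lies at a zero
  -- of M.
  have hMz : (coeffM ℂ).eval z = 0 := by
    have h2 := congrArg (eval z) h1
    simp [hpz, hk1, hUz, hVz] at h2
    exact h2
  obtain ⟨S, hS⟩ := dvd_iff_isRoot.2 hMz
  rw [← hp] at hS
  have h3 : S * (derivative U * p * V - (k + 1) * U * V - U * p * derivative V) =
      coeffβ ℂ * p ^ (k + 1) * V ^ 2 + coeffα ℂ * U * V := by
    refine mul_left_cancel₀ hp0 ?_
    rw [hS] at h1
    linear_combination h1
  have hSz : S.eval z = 4 * z ^ 3 + 6 * z := by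
    have h4 := congrArg (eval z) (congrArg derivative hS)
    rw [derivative_mul, hdp] at h4
    simp [hpz, coeffM] at h4
    linear_combination -h4
  have h5 := congrArg (eval z) h3
  simp only [eval_mul, eval_sub, eval_add, eval_pow, hpz, eval_natCast, eval_one, hSz] at h5
  -- The next order gives -(k + 1) M'(z) = α(z), as S(z) = M'(z). It becomes z(k + 2) = -1 when z² =
  -- -1 and z(k + 1) = 3 when z² = -2; squaring contradicts positivity.
  have h6 : -((k : ℂ) + 1) * (4 * z ^ 3 + 6 * z) = 2 * z ^ 3 - 4 * z ^ 2 + 4 * z - 2 := by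
    refine mul_right_cancel₀ (mul_ne_zero hUz hVz) ?_
    have : (coeffα ℂ).eval z = 2 * z ^ 3 - 4 * z ^ 2 + 4 * z - 2 := by simp [coeffα]
    rw [← this]
    linear_combination h5
  have hz2 : (z ^ 2 + 1) * (z ^ 2 + 2) = 0 := by
    simp [coeffM] at hMz
    linear_combination hMz
  rcases mul_eq_zero.1 hz2 with h7 | h7
  · have h8 : z * (k + 2) = -1 := by
      linear_combination (-1 / 2) * h6 + (-(k + 1) * 2 * z - z + 2) * h7
    have h9 : (((k + 2) ^ 2 + 1 : ℕ) : ℂ) = 0 := by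
      push_cast
      linear_combination (-(z * (k + 2)) + 1) * h8 + (k + 2) ^ 2 * h7
    exact absurd h9 (Nat.cast_ne_zero.2 (by positivity))
  · have h8 : z * (k + 1) = 3 := by
      linear_combination (1 / 2) * h6 + ((k + 1) * 2 * z + z - 2) * h7
    have h9 : ((2 * (k + 1) ^ 2 + 9 : ℕ) : ℂ) = 0 := by
      push_cast
      linear_combination (-(z * (k + 1)) - 3) * h8 + (k + 1) ^ 2 * h7
    exact absurd h9 (Nat.cast_ne_zero.2 (by positivity))

/-- In degree d ≥ 3 the leading terms of M U' and αU have coefficients d and 2, and β is too low to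
compensate. For degree at most 2, evaluation at four points gives linear equations that force w = 0.
-/
lemma no_polynomial_solution {U : ℂ[X]} {w : ℂ}
    (h : coeffM ℂ * derivative U = C w * coeffβ ℂ + coeffα ℂ * U) : w = 0 := by
  have hdeg : U.natDegree ≤ 2 := by
    by_contra! hd
    obtain ⟨d, hd⟩ : ∃ d, U.natDegree = d + 3 := ⟨U.natDegree - 3, by omega⟩
    have h1 := congrArg (fun p => coeff p (d + 3 + 3)) h
    have hα : (coeffα ℂ).natDegree ≤ 3 := by unfold coeffα; compute_degree
    have hβ : (coeffβ ℂ).natDegree ≤ 4 := by unfold coeffβ; compute_degree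
    have hM : (coeffM ℂ).natDegree ≤ 4 := by unfold coeffM; compute_degree
    have hU' : (derivative U).natDegree ≤ d + 2 :=
      (natDegree_derivative_le U).trans (by omega)
    simp only [coeff_add, coeff_C_mul] at h1
    rw [show d + 3 + 3 = 4 + (d + 2) by ring, coeff_mul_add_eq_of_natDegree_le hM hU',
      show 4 + (d + 2) = 3 + (d + 3) by ring, coeff_mul_add_eq_of_natDegree_le hα hd.le,
      coeff_eq_zero_of_natDegree_lt (p := coeffβ ℂ) (by omega), coeff_derivative] at h1
    have hM4 : (coeffM ℂ).coeff 4 = 1 := by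
      unfold coeffM; compute_degree!
    have hα3 : (coeffα ℂ).coeff 3 = 2 := by
      unfold coeffα; compute_degree!
    have hlead : U.coeff (d + 3) ≠ 0 := by
      rw [← hd]
      exact leadingCoeff_ne_zero.2 fun h0 => by simp [h0] at hd
    rw [hM4, hα3] at h1
    push_cast at h1
    have h2 : U.coeff (d + 3) * ((d + 1 : ℕ) : ℂ) = 0 := by
      push_cast
      linear_combination h1
    exact (mul_ne_zero hlead (Nat.cast_ne_zero.2 d.succ_ne_zero)) h2
  have hU : U = C (U.coeff 2) * X ^ 2 + C (U.coeff 1) * X + C (U.coeff 0) := by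
    conv_lhs => rw [U.as_sum_range_C_mul_X_pow' (n := 3) (by omega)]
    simp [Finset.sum_range_succ]
    ring
  generalize U.coeff 2 = u₂ at hU
  generalize U.coeff 1 = u₁ at hU
  generalize U.coeff 0 = u₀ at hU
  have heval : ∀ z : ℂ, (z ^ 4 + 3 * z ^ 2 + 2) * (2 * u₂ * z + u₁) =
      w * (2 * z ^ 4 + 4 * z ^ 2 + 4) +
        (2 * z ^ 3 - 4 * z ^ 2 + 4 * z - 2) * (u₂ * z ^ 2 + u₁ * z + u₀) := fun z => by
    have := congrArg (eval z) h
    rw [hU] at this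
    simp [coeffM, coeffβ, coeffα] at this
    linear_combination this
  have e0 := heval 0
  have e1 := heval 1
  have e2 := heval (-1)
  have e3 := heval 2
  ring_nf at e0 e1 e2 e3
  grind

/-- Over ℂ every nonconstant denominator has a root; dividing by the gcd turns such roots into
genuine poles. -/
lemma no_rational_solution {U W : ℝ[X]} (hW : W ≠ 0)
    (h : coeffM ℝ * (derivative U * W - U * derivative W) =
      coeffβ ℝ * W ^ 2 + coeffα ℝ * U * W) : False := by
  set f := algebraMap ℝ ℂ
  have hW' : W.map f ≠ 0 := (Polynomial.map_ne_zero_iff f.injective).2 hW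
  have hmap := congrArg (Polynomial.map f) h
  have hM : (coeffM ℝ).map f = coeffM ℂ := by simp [coeffM]
  have hα : (coeffα ℝ).map f = coeffα ℂ := by simp [coeffα]
  have hβ : (coeffβ ℝ).map f = coeffβ ℂ := by simp [coeffβ]
  simp only [Polynomial.map_mul, Polynomial.map_sub, Polynomial.map_add, Polynomial.map_pow,
    ← derivative_map, hM, hα, hβ] at hmap
  generalize W.map f = W₁ at *
  generalize U.map f = U₁ at *
  obtain ⟨U₀, hU₀⟩ := EuclideanDomain.gcd_dvd_left U₁ W₁
  obtain ⟨W₀, hW₀⟩ := EuclideanDomain.gcd_dvd_right U₁ W₁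
  have hd : EuclideanDomain.gcd U₁ W₁ ≠ 0 := fun h0 => hW' (by rw [hW₀, h0, zero_mul])
  have hc : IsCoprime U₀ W₀ := by
    refine ⟨EuclideanDomain.gcdA U₁ W₁, EuclideanDomain.gcdB U₁ W₁, mul_left_cancel₀ hd ?_⟩
    have := EuclideanDomain.gcd_eq_gcd_ab U₁ W₁
    linear_combination (-1 : ℂ[X]) * this - EuclideanDomain.gcdA U₁ W₁ * hU₀
      - EuclideanDomain.gcdB U₁ W₁ * hW₀
  generalize EuclideanDomain.gcd U₁ W₁ = d at *
  have hW₀0 : W₀ ≠ 0 := fun h0 => hW' (by rw [hW₀, h0, mul_zero])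
  have heq : coeffM ℂ * (derivative U₀ * W₀ - U₀ * derivative W₀) =
      coeffβ ℂ * W₀ ^ 2 + coeffα ℂ * U₀ * W₀ := by
    refine mul_left_cancel₀ (pow_ne_zero 2 hd) ?_
    rw [hU₀, hW₀, derivative_mul, derivative_mul] at hmap
    linear_combination hmap
  have hdeg := denominator_natDegree_eq_zero hW₀0 hc heq
  obtain ⟨w, rfl⟩ := natDegree_eq_zero.1 hdeg
  refine hW₀0 ?_
  rw [no_polynomial_solution (U := U₀) (w := w) ?_, C_0]
  refine mul_left_cancel₀ hW₀0 ?_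
  rw [derivative_C] at heq
  linear_combination heq

end NoRationalSolution

end RationalSolutions

/-! ### The limit cycle is not algebraic -/

section Algebraicity

open Polynomial Polynomial.Bivariate

/-- `x⁻²` along the limit cycle, in the chart `y = t x`. -/
def slopeInvSq (t : ℝ) : ℝ := invSq 0 (Real.arctan t) * (1 + t ^ 2)

lemma slopeInvSq_pos (t : ℝ) : 0 < slopeInvSq t :=
  mul_pos (invSq_zero_pos _) (by positivity)

lemma eval_coeffM (t : ℝ) : (coeffM ℝ).eval t = (2 + t ^ 2) * (1 + t ^ 2) := by
  simp [coeffM]; ring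

lemma hasDerivAt_slopeInvSq (t : ℝ) : HasDerivAt slopeInvSq
    (((coeffβ ℝ).eval t + (coeffα ℝ).eval t * slopeInvSq t) / (coeffM ℝ).eval t) t := by
  have h := ((hasDerivAt_invSq 0 (Real.arctan t)).comp t (Real.hasDerivAt_arctan t)).fun_mul
    (((hasDerivAt_id' t).fun_pow 2).const_add 1)
  refine h.congr_deriv ?_
  have hα : (coeffα ℝ).eval t = 2 * t ^ 3 - 4 * t ^ 2 + 4 * t - 2 := by simp [coeffα]
  have hβ : (coeffβ ℝ).eval t = 2 * t ^ 4 + 4 * t ^ 2 + 4 := by simp [coeffβ]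
  have hpos : 0 < 1 + t ^ 2 := by positivity
  have hc := Real.cos_sq_arctan t
  rw [eval_coeffM, hα, hβ, slopeInvSq, Real.sin_sq, hc,
    show Real.cos (Real.arctan t) ^ 4 = (Real.cos (Real.arctan t) ^ 2) ^ 2 by ring, hc]
  simp only [Function.comp_apply]
  have h2 : 0 < 1 + 1 / (1 + t ^ 2) := by positivity
  have h3 : 1 + 1 / (1 + t ^ 2) = (2 + t ^ 2) / (1 + t ^ 2) := by field_simp; ring
  rw [h3]
  field_simp
  ring

/-- The angle arctan t parametrizes the half of the cycle with x > 0, where x = q^(-1/2). -/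
lemma mem_polarCurve_slope (t : ℝ) :
    ((√(slopeInvSq t))⁻¹, t * (√(slopeInvSq t))⁻¹) ∈ polarCurve radius := by
  refine ⟨Real.arctan t, ?_⟩
  simp only [radius_eq]
  rw [slopeInvSq, Real.sqrt_mul (invSq_zero_pos _).le, Real.cos_arctan, Real.sin_arctan]
  ext
  · simp only [mul_inv, one_div]
  · simp only [mul_inv]
    ring

/-- The bivariate polynomial `F(x, t x)`, with `x` as the outer variable. -/
def slopeChart : MvPolynomial (Fin 2) ℝ →ₐ[ℝ] ℝ[X][Y] := MvPolynomial.aeval ![Y, C X * Y]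

lemma evalEval_slopeChart (F : MvPolynomial (Fin 2) ℝ) (t x : ℝ) :
    (slopeChart F).evalEval t x = polyEval F (x, t * x) := by
  have h : ((evalEvalRingHom t x).comp (slopeChart : MvPolynomial (Fin 2) ℝ →+* ℝ[X][Y])) =
      MvPolynomial.eval ![x, t * x] := by
    refine MvPolynomial.ringHom_ext (fun r => ?_) fun i => ?_
    · simp [slopeChart]
    · fin_cases i
      · simp [slopeChart]
      · simp [slopeChart]
        ring
  exact DFunLike.congr_fun h F

/-- The chart reaches every point with x ≠ 0; multiplying F by x removes the remaining line. -/
lemma slopeChart_ne_zero {F : MvPolynomial (Fin 2) ℝ} (hF : F ≠ 0) : slopeChart F ≠ 0 := fun h => by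
  refine mul_ne_zero hF (MvPolynomial.X_ne_zero (R := ℝ) (0 : Fin 2))
    (MvPolynomial.funext fun v => ?_)
  rw [map_mul, MvPolynomial.eval_X, map_zero, mul_eq_zero, or_iff_not_imp_right]
  intro hv
  have h1 := evalEval_slopeChart F (v 1 / v 0) (v 0)
  rw [h, evalEval_zero, div_mul_cancel₀ _ hv, polyEval] at h1
  have h2 : ![v 0, v 1] = v := by
    ext i; fin_cases i <;> rfl
  rw [← h2]
  exact h1.symm

lemma exists_even_odd_parts {R : Type*} [CommRing R] (H : R[X]) :
    ∃ A B : R[X], H = expand R 2 A + X * expand R 2 B := by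
  induction H using Polynomial.induction_on' with
  | add p q hp hq =>
    obtain ⟨A, B, hp⟩ := hp
    obtain ⟨A', B', hq⟩ := hq
    refine ⟨A + A', B + B', ?_⟩
    rw [hp, hq, map_add, map_add]
    ring
  | monomial n a =>
    rcases Nat.even_or_odd' n with ⟨k, rfl | rfl⟩
    · refine ⟨monomial k a, 0, ?_⟩
      rw [expand_monomial, map_zero, mul_zero, add_zero, mul_comm]
    · refine ⟨0, monomial k a, ?_⟩
      rw [expand_monomial, map_zero, zero_add, X_mul_monomial, mul_comm]

/-- The degree of A² is even and that of X B² is odd, so they cannot cancel. -/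
lemma sq_sub_X_mul_sq_ne_zero {R : Type*} [CommRing R] [IsDomain R] {A B : R[X]}
    (h : A ≠ 0 ∨ B ≠ 0) : A ^ 2 - X * B ^ 2 ≠ 0 := fun h0 => by
  rw [sub_eq_zero] at h0
  by_cases hB : B = 0
  · subst hB
    simp at h0
    simp [h0] at h
  · have h1 := congrArg natDegree h0
    rw [natDegree_pow, natDegree_X_mul (pow_ne_zero 2 hB), natDegree_pow] at h1
    omega

lemma evalEval_expand (A : ℝ[X][Y]) (t x : ℝ) :
    (expand ℝ[X] 2 A).evalEval t x = A.evalEval t (x ^ 2) := by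
  rw [evalEval, expand_eval, evalEval, C_pow]

/-- A polynomial vanishing on the limit cycle makes `slopeInvSq` an algebraic function. -/
lemma exists_algebraic_relation {F : MvPolynomial (Fin 2) ℝ} (hF : F ≠ 0)
    (h : ∀ z ∈ polarCurve radius, polyEval F z = 0) :
    ∃ G : ℝ[X][Y], G ≠ 0 ∧ ∀ t, G.evalEval t (slopeInvSq t) = 0 := by
  obtain ⟨A, B, hAB⟩ := exists_even_odd_parts (slopeChart F)
  have hne : A ≠ 0 ∨ B ≠ 0 := by
    by_contra! h0
    refine slopeChart_ne_zero hF ?_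
    rw [hAB, h0.1, h0.2]
    simp
  -- Multiplying A(x²) + x B(x²) = 0 by its conjugate leaves a relation in x² = 1/q; reversing the
  -- polynomial turns it into one for q.
  refine ⟨(A ^ 2 - X * B ^ 2).reverse, reverse_eq_zero.not.2 (sq_sub_X_mul_sq_ne_zero hne),
    fun t => ?_⟩
  have hq := slopeInvSq_pos t
  have h1 := h _ (mem_polarCurve_slope t)
  rw [← evalEval_slopeChart, hAB, evalEval_add, evalEval_mul, evalEval_X, evalEval_expand,
    evalEval_expand, inv_pow, Real.sq_sqrt hq.le] at h1
  let _ : Invertible (slopeInvSq t)⁻¹ := invertibleOfNonzero (inv_ne_zero hq.ne')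
  have h2 := eval₂_reverse_eq_zero_iff (evalRingHom t) (slopeInvSq t)⁻¹ (A ^ 2 - X * B ^ 2)
  rw [invOf_eq_inv, inv_inv, eval₂_evalRingHom] at h2
  refine h2.2 ?_
  rw [evalEval_sub, evalEval_mul, evalEval_pow, evalEval_pow, evalEval_X]
  have h3 : (√(slopeInvSq t))⁻¹ ^ 2 = (slopeInvSq t)⁻¹ := by rw [inv_pow, Real.sq_sqrt hq.le]
  linear_combination
    (A.evalEval t (slopeInvSq t)⁻¹ - (√(slopeInvSq t))⁻¹ * B.evalEval t (slopeInvSq t)⁻¹) * h1 +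
      (B.evalEval t (slopeInvSq t)⁻¹) ^ 2 * h3

lemma not_isAlgebraicOrbit_polarCurve :
    ¬ IsAlgebraicOrbit quinticP quinticQ (polarCurve radius) := by
  rintro ⟨-, F, ⟨hF, -⟩, h⟩
  obtain ⟨U, W, hW, hUW⟩ := exists_rational_solution
    (fun t => by rw [eval_coeffM]; positivity) hasDerivAt_slopeInvSq
    (exists_algebraic_relation hF h)
  exact no_rational_solution hW hUW

end Algebraicity

end PlanarSystem

end

theorem theorem1p1 :
    -- the explicit polar curve is well defined and closes up
    (∀ θ : ℝ, 0 < radicand θ) ∧ Function.Periodic radius (2 * Real.pi) ∧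
    -- the system has exactly one limit cycle, namely that curve
    (∀ Γ : Set (ℝ × ℝ), IsLimitCycle (polyField quinticP quinticQ) Γ ↔ Γ = polarCurve radius) ∧
    IsHyperbolic (polyField quinticP quinticQ) (polarCurve radius) ∧
    ¬ IsAlgebraicOrbit quinticP quinticQ (polarCurve radius) ∧
    -- `a ≈ 1.19903`, correct to the five decimals shown
    |aConst - 1.19903| ≤ 0.000005 := by
  exact ⟨radicand_pos, radius_periodic, isLimitCycle_iff, isHyperbolic_polarCurve,
    not_isAlgebraicOrbit_polarCurve, abs_aConst_sub_le⟩
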